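/- **Theorem (perfect parallel repetition for XOR games).** An XOR game $G=(f,\pi)$ consists of finite sets $S,T$, a predicate $f:S\times T\to\{0,1\}$ and a probability distribution $\pi$ on $S\times T$: the verifier draws $(s,t)\sim\pi$, sends $s$ to Alice and $t$ to Bob, receives bits $a$ from Alice and $b$ from Bob, and accepts if and only if $a\oplus b=f(s,t)$. The conjunction $\bigwedge_{j=1}^n G_j$ of XOR games $G_j=(f_j,\pi_j)$ on $S_j\times T_j$ is the game in which $((s_1,t_1),\dots,(s_n,t_n))$ is drawn from $\pi_1\times\cdots\times\pi_n$, Alice receives $(s_1,\dots,s_n)$ and answers with bits $a_1,\dots,a_n$, Bob receives $(t_1,\dots,t_n)$ and answers with bits $b_1,\dots,b_n$, and they win if and only if $a_j\oplus b_j=f_j(s_j,t_j)$ for all $j$. A quantum strategy consists of a unit vector $|\psi\rangle\in\mathcal A\otimes\mathcal B$, where $\mathcal A,\mathcal B$ are finite-dimensional complex Hilbert spaces, a measurement (POVM) $\{X_s^a\}_a$ on $\mathcal A$ for every question $s$ to Alice, and a measurement $\{Y_t^b\}_b$ on $\mathcal B$ for every question $t$ to Bob; on questions $(s,t)$ the answers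 are $(a,b)$ with probability $\langle\psi|X_s^a\otimes Y_t^b|\psi\rangle$. The quantum value $\omega_q$ of a game is the maximum success probability over all quantum strategies (of all finite dimensions). For any XOR games $G_1,\dots,G_n$, the maxima defining $\omega_q(G_1),\dots,\omega_q(G_n)$ and $\omega_q(\bigwedge_{j=1}^n G_j)$ are attained, and $$\omega_q\Bigl(\bigwedge_{j=1}^n G_j\Bigr)=\prod_{j=1}^n\omega_q(G_j).$$ -/

import Mathlib

open scoped Kronecker ComplexOrder

/-- A one-round two-player game with finite question sets `S`, `T` and answer sets `A`, `B`:
the verifier draws `(s, t)` with probability `prob s t`, and accepts the answers `(a, b)`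
if and only if `accept s t a b = true`. -/
structure TwoPlayerGame (S T A B : Type*) [Fintype S] [Fintype T] where
  prob : S → T → ℝ
  prob_nonneg : ∀ s t, 0 ≤ prob s t
  prob_sum : ∑ s, ∑ t, prob s t = 1
  accept : S → T → A → B → Bool

/-- An XOR game `(f, π)`: a predicate `f` on `S × T` and a probability distribution `π`
on `S × T`. -/
structure XORGame (S T : Type*) [Fintype S] [Fintype T] where
  f : S → T → Bool
  prob : S → T → ℝ
  prob_nonneg : ∀ s t, 0 ≤ prob s t
  prob_sum : ∑ s, ∑ t, prob s t = 1

/-- The two-player game described by an XOR game: the players answer with one bit each and win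
if and only if `a ⊕ b = f s t`. -/
def XORGame.toGame {S T : Type*} [Fintype S] [Fintype T] (G : XORGame S T) :
    TwoPlayerGame S T Bool Bool where
  prob := G.prob
  prob_nonneg := G.prob_nonneg
  prob_sum := G.prob_sum
  accept s t a b := decide (Bool.xor a b = G.f s t)

/-- The conjunction of the XOR games `G 0, …, G (n - 1)`: the questions are drawn from the product
distribution, Alice receives all the `s j` and Bob all the `t j`, each of them answers with `n`
bits, and they win if and only if `a j ⊕ b j = f j (s j) (t j)` for every `j`. -/
def XORGame.conjunction {n : ℕ} {S T : Fin n → Type*} [∀ j, Fintype (S j)] [∀ j, Fintype (T j)]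
    (G : ∀ j, XORGame (S j) (T j)) :
    TwoPlayerGame (∀ j, S j) (∀ j, T j) (Fin n → Bool) (Fin n → Bool) where
  prob s t := ∏ j, (G j).prob (s j) (t j)
  prob_nonneg s t := Finset.prod_nonneg fun j _ => (G j).prob_nonneg (s j) (t j)
  prob_sum := by
    have h : ∀ s : (∀ j, S j), ∑ t : (∀ j, T j), ∏ j, (G j).prob (s j) (t j)
        = ∏ j, ∑ t, (G j).prob (s j) t := fun s =>
      (Fintype.prod_sum fun j t => (G j).prob (s j) t).symm
    simp only [h]
    rw [← Fintype.prod_sum fun j s => ∑ t, (G j).prob s t]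
    simp [(G _).prob_sum]
  accept s t a b := decide (∀ j, Bool.xor (a j) (b j) = (G j).f (s j) (t j))

/-- A measurement (POVM) with outcomes in `A` on the space `ℂ^ι`. -/
structure POVM (A ι : Type*) [Fintype A] [Fintype ι] [DecidableEq ι] where
  effect : A → Matrix ι ι ℂ
  posSemidef : ∀ a, (effect a).PosSemidef
  sum_eq_one : ∑ a, effect a = 1

/-- A quantum strategy with local spaces `ℂ^ι` (Alice) and `ℂ^κ` (Bob): a shared unit vector in
`ℂ^ι ⊗ ℂ^κ = ℂ^(ι × κ)`, and for each question a measurement by the player who receives it on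
that player's part of the state. -/
structure QuantumStrategy (S T A B ι κ : Type*) [Fintype A] [Fintype B]
    [Fintype ι] [DecidableEq ι] [Fintype κ] [DecidableEq κ] where
  state : ι × κ → ℂ
  state_unit : star state ⬝ᵥ state = 1
  alice : S → POVM A ι
  bob : T → POVM B κ

section Strategy

variable {S T A B ι κ : Type*} [Fintype S] [Fintype T] [Fintype A] [Fintype B]
  [Fintype ι] [DecidableEq ι] [Fintype κ] [DecidableEq κ]

/-- The probability `⟨ψ| X_s^a ⊗ Y_t^b |ψ⟩` that the answers are `(a, b)` when the questions
are `(s, t)`. -/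
noncomputable def QuantumStrategy.answerProb (σ : QuantumStrategy S T A B ι κ)
    (s : S) (t : T) (a : A) (b : B) : ℝ :=
  (star σ.state ⬝ᵥ (((σ.alice s).effect a ⊗ₖ (σ.bob t).effect b).mulVec σ.state)).re

/-- The success probability of a quantum strategy on a game. -/
noncomputable def QuantumStrategy.successProb (σ : QuantumStrategy S T A B ι κ)
    (G : TwoPlayerGame S T A B) : ℝ :=
  ∑ s, ∑ t, G.prob s t *
    ∑ a, ∑ b, if G.accept s t a b = true then σ.answerProb s t a b else 0

end Strategy

/-- The set of the success probabilities of all quantum strategies for `G`, with local spaces of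
arbitrary finite dimensions. -/
def TwoPlayerGame.quantumSuccessProbs {S T A B : Type*} [Fintype S] [Fintype T]
    [Fintype A] [Fintype B] (G : TwoPlayerGame S T A B) : Set ℝ :=
  {p | ∃ (ι κ : Type) (_ : Fintype ι) (_ : DecidableEq ι) (_ : Fintype κ) (_ : DecidableEq κ)
    (σ : QuantumStrategy S T A B ι κ), σ.successProb G = p}

/-- The quantum value of a game. -/
noncomputable def TwoPlayerGame.quantumValue {S T A B : Type*} [Fintype S] [Fintype T]
    [Fintype A] [Fintype B] (G : TwoPlayerGame S T A B) : ℝ :=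
  sSup G.quantumSuccessProbs

/-! By Tsirelson's theorem the value of one XOR game is `(1 + e) / 2`, where the bias `e` is the
maximum of a linear functional over real correlation matrices. The maximum exists by compactness. It
is attained by a strategy built from Clifford generators on a maximally entangled state
(`exists_strategy_of_correlation`), and semidefinite duality certifies it
(`exists_dualSlack_posSemidef`).

Playing optimal strategies independently gives `≥` for the conjunction. For `≤`, the indicator of
winning every game expands as an average over subsets `M` of parity characters. The term of `M` is
the correlation, under a product cost matrix, of the parities over `M` of the two players' answers.
Dual certificates multiply under Schur products (`dualSlack_prod_posSemidef`), so this term is at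
most `∏ j ∈ M, e j`. Averaging over `M` gives `∏ j, (1 + e j) / 2`, the product of the individual
values. -/

open Matrix

/-! ### Schur and tensor products of positive semidefinite matrices. -/

section PosSemidef

variable {𝕜 J : Type*} [RCLike 𝕜]

/-- Entrywise products of positive semidefinite matrices are positive semidefinite. -/
theorem Matrix.PosSemidef.entrywise_prod {m : Type*} (J' : Finset J) {N : J → Matrix m m 𝕜}
    (hN : ∀ j, (N j).PosSemidef) : (Matrix.of fun a b => ∏ j ∈ J', N j a b).PosSemidef := by
  classical
  induction J' using Finset.induction_on with
  | empty =>
    -- The empty product is the all-ones matrix, a pullback of the `1 × 1` identity.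
    have h : (Matrix.of fun a b => ∏ j ∈ (∅ : Finset J), N j a b)
        = (1 : Matrix Unit Unit 𝕜).submatrix (fun _ : m => ()) (fun _ => ()) := by
      ext a b; simp
    rw [h]
    exact PosSemidef.one.submatrix _
  | insert j J' hj ih =>
    convert (hN j).hadamard ih using 1
    ext a b
    simp [Finset.prod_insert hj, Matrix.hadamard]

variable [Fintype J] {m : J → Type*}

/-- The tensor product of a finite family of square matrices. -/
def Matrix.piTensor (N : ∀ j, Matrix (m j) (m j) 𝕜) : Matrix (∀ j, m j) (∀ j, m j) 𝕜 :=
  Matrix.of fun a b => ∏ j, N j (a j) (b j)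

theorem Matrix.PosSemidef.piTensor {N : ∀ j, Matrix (m j) (m j) 𝕜}
    (hN : ∀ j, (N j).PosSemidef) : (Matrix.piTensor N).PosSemidef :=
  PosSemidef.entrywise_prod Finset.univ (N := fun j => (N j).submatrix
    (fun a : (∀ j, m j) => a j) (fun a => a j))
    fun j => (hN j).submatrix _

end PosSemidef

/-! ### Dual certificates and their products. -/

section Certificate

variable {S T : Type*} [DecidableEq S] [DecidableEq T]

/-- The slack matrix of the semidefinite program dual to the maximisation of the bias: if it is
positive semidefinite then `(∑ p + ∑ q) / 2` bounds the bias of the cost matrix `C`. -/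
def dualSlack (C : Matrix S T ℝ) (p : S → ℝ) (q : T → ℝ) : Matrix (S ⊕ T) (S ⊕ T) ℝ :=
  fromBlocks (diagonal p) C Cᵀ (diagonal q)

theorem dualSlack_isHermitian (C : Matrix S T ℝ) (p : S → ℝ) (q : T → ℝ) :
    (dualSlack C p q).IsHermitian := by
  unfold dualSlack
  rw [IsHermitian, fromBlocks_conjTranspose]
  simp [conjTranspose_eq_transpose_of_trivial]

theorem dualSlack_posSemidef [Fintype S] [Fintype T] {C : Matrix S T ℝ} {p : S → ℝ} {q : T → ℝ}
    (h : ∀ (x : S → ℝ) (y : T → ℝ),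
      0 ≤ ∑ s, p s * x s ^ 2 + 2 * ∑ s, ∑ t, C s t * (x s * y t) + ∑ t, q t * y t ^ 2) :
    (dualSlack C p q).PosSemidef := by
  refine PosSemidef.of_dotProduct_mulVec_nonneg (dualSlack_isHermitian C p q) fun z => ?_
  refine (h (z ∘ Sum.inl) (z ∘ Sum.inr)).trans_eq (Eq.symm ?_)
  have h1 : ∑ t, z (Sum.inr t) * ∑ s, C s t * z (Sum.inl s)
      = ∑ s, z (Sum.inl s) * ∑ t, C s t * z (Sum.inr t) := by
    simp_rw [Finset.mul_sum]
    rw [Finset.sum_comm]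
    exact Finset.sum_congr rfl fun _ _ => Finset.sum_congr rfl fun _ _ => by ring
  have h2 : ∑ s, z (Sum.inl s) * ∑ t, C s t * z (Sum.inr t)
      = ∑ s, ∑ t, C s t * (z (Sum.inl s) * z (Sum.inr t)) := by
    simp_rw [Finset.mul_sum]
    exact Finset.sum_congr rfl fun _ _ => Finset.sum_congr rfl fun _ _ => by ring
  simp only [dualSlack, dotProduct, mulVec, Fintype.sum_sum_type, fromBlocks_apply₁₁,
    fromBlocks_apply₁₂, fromBlocks_apply₂₁, fromBlocks_apply₂₂, diagonal_apply, ite_mul, zero_mul,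
    Finset.sum_ite_eq, Finset.mem_univ, if_true, Pi.star_apply, star_trivial, mul_add,
    Finset.sum_add_distrib, transpose_apply, Function.comp_apply]
  rw [h1, h2]
  have h3 : ∀ s, z (Sum.inl s) * (p s * z (Sum.inl s)) = p s * z (Sum.inl s) ^ 2 := fun s => by ring
  have h4 : ∀ s, z (Sum.inr s) * (q s * z (Sum.inr s)) = q s * z (Sum.inr s) ^ 2 := fun s => by ring
  simp only [h3, h4]
  ring

/-- Dual certificates multiply under tensor products of cost matrices. -/
theorem dualSlack_prod_posSemidef {J : Type*} [Fintype J] {S T : J → Type*}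
    [∀ j, DecidableEq (S j)] [∀ j, DecidableEq (T j)]
    {C : ∀ j, Matrix (S j) (T j) ℝ} {p : ∀ j, S j → ℝ} {q : ∀ j, T j → ℝ}
    (h : ∀ j, (dualSlack (C j) (p j) (q j)).PosSemidef) :
    (dualSlack (Matrix.of fun (s : ∀ j, S j) (t : ∀ j, T j) => ∏ j, C j (s j) (t j))
      (fun s => ∏ j, p j (s j)) (fun t => ∏ j, q j (t j))).PosSemidef := by
  -- Pull each slack matrix back along the `j`-th projection and take the Schur product. The
  -- diagonal blocks stay diagonal because distinct tuples differ in some coordinate.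
  have := PosSemidef.entrywise_prod Finset.univ
    (N := fun j => (dualSlack (C j) (p j) (q j)).submatrix
      (Sum.map (· j) (· j) : (∀ j, S j) ⊕ (∀ j, T j) → S j ⊕ T j) (Sum.map (· j) (· j)))
    fun j => (h j).submatrix _
  refine cast (congrArg Matrix.PosSemidef (Eq.symm ?_)) this
  ext (s | t) (s' | t')
  · by_cases hs : s = s'
    · subst hs; simp [dualSlack]
    · obtain ⟨j, hj⟩ := Function.ne_iff.mp hs
      simp only [dualSlack, fromBlocks_apply₁₁, diagonal_apply_ne _ hs, of_apply, submatrix_apply,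
        Sum.map_inl]
      refine (Finset.prod_eq_zero (Finset.mem_univ j) ?_).symm
      exact diagonal_apply_ne _ hj
  · simp [dualSlack]
  · simp [dualSlack]
  · by_cases hs : t = t'
    · subst hs; simp [dualSlack]
    · obtain ⟨j, hj⟩ := Function.ne_iff.mp hs
      simp only [dualSlack, fromBlocks_apply₂₂, diagonal_apply_ne _ hs, of_apply, submatrix_apply,
        Sum.map_inr]
      refine (Finset.prod_eq_zero (Finset.mem_univ j) ?_).symm
      exact diagonal_apply_ne _ hj

end Certificate

/-! ### Compactness and perturbation of correlation matrices. -/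

section Correlation

/-- The correlation matrices: positive semidefinite with unit diagonal. -/
def correlationMatrices (m : Type*) : Set (Matrix m m ℝ) :=
  {R | R.PosSemidef ∧ ∀ a, R a a = 1}

theorem correlationMatrices_nonempty {m : Type*} : (correlationMatrices m).Nonempty := by
  classical exact ⟨1, PosSemidef.one, fun a => by simp⟩

variable {m : Type*} [Fintype m]

/-- Positivity of the quadratic form on the sum and difference of two basis vectors. -/
theorem abs_le_one_of_mem_correlationMatrices {R : Matrix m m ℝ}
    (hR : R ∈ correlationMatrices m) (a b : m) : |R a b| ≤ 1 := by
  classical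
  have hsymm : R b a = R a b := by simpa using hR.1.isHermitian.apply a b
  have key : ∀ c : ℝ, 0 ≤ 1 + 2 * c * R a b + c ^ 2 := fun c => by
    have := hR.1.dotProduct_mulVec_nonneg (Pi.single a 1 + Pi.single b c)
    simp only [star_trivial, mulVec_add, dotProduct_add, add_dotProduct, single_dotProduct,
      mulVec_single, Pi.smul_apply, col_apply, MulOpposite.smul_eq_mul_unop, MulOpposite.unop_op,
      hR.2, hsymm] at this
    linarith
  have h1 := key 1
  have h2 := key (-1)
  rw [abs_le]
  constructor <;> linarith

theorem isCompact_correlationMatrices : IsCompact (correlationMatrices m) := by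
  have hb : correlationMatrices m ⊆
      Set.univ.pi fun _ : m => Set.univ.pi fun _ : m => Set.Icc (-1 : ℝ) 1 := fun R hR a _ b _ =>
    abs_le.mp (abs_le_one_of_mem_correlationMatrices hR a b)
  refine (isCompact_univ_pi fun _ => isCompact_univ_pi fun _ => isCompact_Icc).of_isClosed_subset
    ?_ hb
  have : correlationMatrices m = {R : Matrix m m ℝ | Rᴴ = R} ∩
      (⋂ x : m → ℝ, {R | 0 ≤ star x ⬝ᵥ (R *ᵥ x)}) ∩ ⋂ a, {R | R a a = 1} := by
    ext R
    simp [correlationMatrices, posSemidef_iff_dotProduct_mulVec, IsHermitian]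
  rw [this]
  refine ((isClosed_eq (by fun_prop) continuous_id).inter
    (isClosed_iInter fun x => isClosed_le continuous_const ?_)).inter
    (isClosed_iInter fun a => isClosed_eq ?_ continuous_const)
  · exact Continuous.dotProduct continuous_const (Continuous.matrix_mulVec continuous_id
      continuous_const)
  · exact continuous_id.matrix_elem a a

/-- Mixing a rank-one direction into a correlation matrix and renormalising the diagonal. -/
theorem perturb_mem_correlationMatrices {R : Matrix m m ℝ} (hR : R ∈ correlationMatrices m)
    (z : m → ℝ) {h : ℝ} (hh : 0 ≤ h) :
    (Matrix.of fun a b => (√(1 + h * z a ^ 2))⁻¹ * (R a b + h * (z a * z b)) *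
      (√(1 + h * z b ^ 2))⁻¹) ∈ correlationMatrices m := by
  classical
  constructor
  · have h1 : (R + h • vecMulVec z (star z)).PosSemidef :=
      hR.1.add ((posSemidef_vecMulVec_self_star z).smul hh)
    convert h1.conjTranspose_mul_mul_same (diagonal fun a => (√(1 + h * z a ^ 2))⁻¹) using 1
    ext a b
    simp [vecMulVec_apply]
  · intro a
    have h0 : 0 < 1 + h * z a ^ 2 := by positivity
    have h1 := Real.mul_self_sqrt h0.le
    simp only [of_apply, hR.2]
    rw [← sq, mul_right_comm, ← mul_inv, h1, inv_mul_cancel₀ h0.ne']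

theorem hasDerivAt_inv_sqrt_one_add_mul (c : ℝ) :
    HasDerivAt (fun h : ℝ => (√(1 + h * c))⁻¹) (-c / 2) 0 := by
  have h1 : HasDerivAt (fun h : ℝ => 1 + h * c) c 0 := by
    simpa using ((hasDerivAt_id (0 : ℝ)).mul_const c).const_add 1
  have h2 := (h1.sqrt (by simp)).inv (by simp)
  exact h2.congr_deriv (by simp; ring)

/-- Only right difference quotients are used, since the perturbation of a correlation matrix is
available only for `h ≥ 0`. -/
theorem nonpos_deriv_of_le {F : ℝ → ℝ} {F' : ℝ} (hF : HasDerivAt F F' 0)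
    (hle : ∀ h, 0 ≤ h → F h ≤ F 0) : F' ≤ 0 := by
  have h1 := (hasDerivWithinAt_iff_tendsto_slope' (s := Set.Ioi 0) (by simp)).mp
    hF.hasDerivWithinAt
  refine le_of_tendsto h1 ?_
  filter_upwards [self_mem_nhdsWithin] with h hh
  rw [slope_def_field]
  exact div_nonpos_of_nonpos_of_nonneg (by linarith [hle h (le_of_lt hh)])
    (by simpa using le_of_lt hh)

end Correlation

/-! ### Strong duality for the bias. -/

section Duality

variable {S T : Type*} [Fintype S] [Fintype T]

/-- The value of a cost matrix on a correlation matrix. -/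
def correlationValue (C : Matrix S T ℝ) (R : Matrix (S ⊕ T) (S ⊕ T) ℝ) : ℝ :=
  ∑ s, ∑ t, C s t * R (Sum.inl s) (Sum.inr t)

theorem exists_isMaxOn_correlationValue (C : Matrix S T ℝ) :
    ∃ R ∈ correlationMatrices (S ⊕ T),
      ∀ R' ∈ correlationMatrices (S ⊕ T), correlationValue C R' ≤ correlationValue C R := by
  have hc : Continuous (correlationValue C) := by
    unfold correlationValue
    exact continuous_finsetSum _ fun s _ => continuous_finsetSum _ fun t _ =>
      continuous_const.mul (continuous_id.matrix_elem _ _)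
  obtain ⟨R, hR, h⟩ := isCompact_correlationMatrices.exists_isMaxOn
    correlationMatrices_nonempty hc.continuousOn
  exact ⟨R, hR, fun R' hR' => h hR'⟩

/-- Strong duality: the maximal value of a cost matrix has a dual certificate. -/
theorem exists_dualSlack_posSemidef [DecidableEq S] [DecidableEq T] {C : Matrix S T ℝ}
    {R : Matrix (S ⊕ T) (S ⊕ T) ℝ} (hR : R ∈ correlationMatrices (S ⊕ T))
    (hmax : ∀ R' ∈ correlationMatrices (S ⊕ T), correlationValue C R' ≤ correlationValue C R) :
    ∃ (p : S → ℝ) (q : T → ℝ), (dualSlack C p q).PosSemidef ∧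
      ∑ s, p s = correlationValue C R ∧ ∑ t, q t = correlationValue C R := by
  -- These multipliers are forced by complementary slackness: they are the row and column sums of
  -- the Schur product of `C` with the off-diagonal block of `R`.
  refine ⟨fun s => ∑ t, C s t * R (Sum.inl s) (Sum.inr t),
    fun t => ∑ s, C s t * R (Sum.inl s) (Sum.inr t), dualSlack_posSemidef fun x y => ?_, rfl,
    Finset.sum_comm⟩
  -- With the sign of `y` flipped, the derivative at `0` of the value along the perturbation is
  -- minus half the quadratic form to be shown nonnegative; maximality of `R` makes it nonpositive.
  let z : S ⊕ T → ℝ := Sum.elim x (-y)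
  let d : S ⊕ T → ℝ → ℝ := fun a h => (√(1 + h * z a ^ 2))⁻¹
  let F : ℝ → ℝ := fun h => ∑ s, ∑ t, C s t * (d (Sum.inl s) h *
    (R (Sum.inl s) (Sum.inr t) + h * (z (Sum.inl s) * z (Sum.inr t))) * d (Sum.inr t) h)
  have hd : ∀ a, HasDerivAt (d a) (-(z a ^ 2) / 2) 0 := fun a =>
    hasDerivAt_inv_sqrt_one_add_mul _
  have hd0 : ∀ a, d a 0 = 1 := fun a => by simp [d]
  have hF : HasDerivAt F (∑ s, ∑ t, C s t * (- (x s ^ 2 + y t ^ 2) / 2 *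
      R (Sum.inl s) (Sum.inr t) - x s * y t)) 0 := by
    refine HasDerivAt.fun_sum fun s _ => HasDerivAt.fun_sum fun t _ => ?_
    have hl : HasDerivAt (fun h : ℝ => R (Sum.inl s) (Sum.inr t) +
        h * (z (Sum.inl s) * z (Sum.inr t))) (z (Sum.inl s) * z (Sum.inr t)) 0 := by
      simpa using ((hasDerivAt_id (0 : ℝ)).mul_const (z (Sum.inl s) * z (Sum.inr t))).const_add
        (R (Sum.inl s) (Sum.inr t))
    exact ((((hd (Sum.inl s)).mul hl).mul (hd (Sum.inr t))).const_mul (C s t)).congr_deriv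
      (by simp [hd0, z]; left; ring)
  have hle : ∀ h, 0 ≤ h → F h ≤ F 0 := fun h hh => by
    have := hmax _ (perturb_mem_correlationMatrices hR z hh)
    have h0 : F 0 = correlationValue C R := by simp [F, hd0, correlationValue]
    rw [h0]
    exact this
  have key := nonpos_deriv_of_le hF hle
  have e : ∑ s, ∑ t, C s t * (- (x s ^ 2 + y t ^ 2) / 2 * R (Sum.inl s) (Sum.inr t) - x s * y t)
      = -(∑ s, ∑ t, C s t * R (Sum.inl s) (Sum.inr t) * x s ^ 2
        + 2 * ∑ s, ∑ t, C s t * (x s * y t)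
        + ∑ s, ∑ t, C s t * R (Sum.inl s) (Sum.inr t) * y t ^ 2) / 2 := by
    simp only [Finset.mul_sum, ← Finset.sum_add_distrib, ← Finset.sum_neg_distrib, Finset.sum_div]
    exact Finset.sum_congr rfl fun _ _ => Finset.sum_congr rfl fun _ _ => by ring
  have e2 : ∑ t, (∑ s, C s t * R (Sum.inl s) (Sum.inr t)) * y t ^ 2
      = ∑ s, ∑ t, C s t * R (Sum.inl s) (Sum.inr t) * y t ^ 2 := by
    simp_rw [Finset.sum_mul]
    exact Finset.sum_comm
  rw [e2]
  simp_rw [Finset.sum_mul]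
  linarith

end Duality

/-! ### Weak duality for vectors. -/

section GramBound

theorem re_star_dotProduct_comm {k : Type*} [Fintype k] (x y : k → ℂ) :
    (star x ⬝ᵥ y).re = (star y ⬝ᵥ x).re := by
  rw [← Complex.conj_re, ← Complex.star_def, ← star_dotProduct_star, star_star,
    dotProduct_comm]

/-- A real positive semidefinite matrix pairs nonnegatively with every complex Gram matrix. -/
theorem Matrix.PosSemidef.sum_mul_re_gram_nonneg {m k : Type*} [Fintype m] [Fintype k]
    {N : Matrix m m ℝ} (hN : N.PosSemidef) (w : m → k → ℂ) :
    0 ≤ ∑ a, ∑ b, N a b * (star (w a) ⬝ᵥ w b).re := by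
  -- The real part of an inner product splits into real and imaginary coordinates, each contributing
  -- a real quadratic form of `N`.
  have h : ∑ a, ∑ b, N a b * (star (w a) ⬝ᵥ w b).re =
      ∑ i, (star (fun a => (w a i).re) ⬝ᵥ (N *ᵥ fun a => (w a i).re)
        + star (fun a => (w a i).im) ⬝ᵥ (N *ᵥ fun a => (w a i).im)) := by
    simp only [dotProduct, mulVec, Finset.mul_sum, ← Finset.sum_add_distrib, Complex.re_sum]
    conv_rhs => rw [Finset.sum_comm]
    refine Finset.sum_congr rfl fun a _ => ?_
    conv_rhs => rw [Finset.sum_comm]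
    refine Finset.sum_congr rfl fun b _ => Finset.sum_congr rfl fun i _ => ?_
    simp
    ring
  rw [h]
  exact Finset.sum_nonneg fun i _ => add_nonneg (hN.dotProduct_mulVec_nonneg _)
    (hN.dotProduct_mulVec_nonneg _)

/-- Pair the slack matrix with the Gram matrix of the vectors `-u s` and `v t`. The norm bounds then
apply because `p` and `q`, being diagonal entries, are nonnegative. -/
theorem sum_mul_re_star_dotProduct_le {S T k : Type*} [Fintype S] [Fintype T] [DecidableEq S]
    [DecidableEq T] [Fintype k] {C : Matrix S T ℝ} {p : S → ℝ} {q : T → ℝ}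
    (h : (dualSlack C p q).PosSemidef) {u : S → k → ℂ} {v : T → k → ℂ}
    (hu : ∀ s, (star (u s) ⬝ᵥ u s).re ≤ 1) (hv : ∀ t, (star (v t) ⬝ᵥ v t).re ≤ 1) :
    ∑ s, ∑ t, C s t * (star (u s) ⬝ᵥ v t).re ≤ (∑ s, p s + ∑ t, q t) / 2 := by
  have hp : ∀ s, 0 ≤ p s := fun s => by simpa [dualSlack] using h.diag_nonneg (i := Sum.inl s)
  have hq : ∀ t, 0 ≤ q t := fun t => by simpa [dualSlack] using h.diag_nonneg (i := Sum.inr t)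
  have key := h.sum_mul_re_gram_nonneg (Sum.elim (fun s => -u s) v)
  have hc : ∑ t, ∑ s, C s t * (star (v t) ⬝ᵥ u s).re = ∑ s, ∑ t, C s t * (star (u s) ⬝ᵥ v t).re := by
    rw [Finset.sum_comm]
    simp_rw [re_star_dotProduct_comm (v _)]
  simp only [dualSlack, Fintype.sum_sum_type, fromBlocks_apply₁₁,
    fromBlocks_apply₁₂, fromBlocks_apply₂₁, fromBlocks_apply₂₂, diagonal_apply, ite_mul, zero_mul,
    Finset.sum_ite_eq, Finset.mem_univ, if_true, transpose_apply, Sum.elim_inl, Sum.elim_inr,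
    star_neg, neg_dotProduct, dotProduct_neg, Complex.neg_re, mul_neg,
    Finset.sum_add_distrib, Finset.sum_neg_distrib, hc] at key
  have h1 : ∑ s, p s * (star (u s) ⬝ᵥ u s).re ≤ ∑ s, p s :=
    Finset.sum_le_sum fun s _ => mul_le_of_le_one_right (hp s) (hu s)
  have h2 : ∑ t, q t * (star (v t) ⬝ᵥ v t).re ≤ ∑ t, q t :=
    Finset.sum_le_sum fun t _ => mul_le_of_le_one_right (hq t) (hv t)
  linarith

end GramBound

/-! ### Observables of measurements. -/

section Observable

variable {A ι : Type*} [Fintype A] [Fintype ι] [DecidableEq ι]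

/-- The observable of a measurement whose outcome `a` is given the real value `α a`. -/
noncomputable def POVM.observable (E : POVM A ι) (α : A → ℝ) : Matrix ι ι ℂ :=
  ∑ a, (α a : ℂ) • E.effect a

theorem POVM.observable_isHermitian (E : POVM A ι) (α : A → ℝ) :
    (E.observable α).IsHermitian := by
  unfold POVM.observable IsHermitian
  rw [conjTranspose_sum]
  refine Finset.sum_congr rfl fun a _ => ?_
  rw [conjTranspose_smul, (E.posSemidef a).isHermitian.eq]
  simp

theorem POVM.observable_posSemidef (E : POVM A ι) {α : A → ℝ} (hα : ∀ a, 0 ≤ α a) :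
    (E.observable α).PosSemidef :=
  posSemidef_sum _ fun a _ => (E.posSemidef a).smul (by exact_mod_cast hα a)

/-- Observables with values in `[-1, 1]` are contractions. -/
theorem POVM.one_sub_observable_sq_posSemidef (E : POVM A ι) {α : A → ℝ} (hα : ∀ a, |α a| ≤ 1) :
    (1 - E.observable α * E.observable α).PosSemidef := by
  set X := E.observable α with hX
  have hXh : Xᴴ = X := E.observable_isHermitian α
  have h1 : (1 - X).PosSemidef := by
    have : 1 - X = E.observable fun a => 1 - α a := by
      simp [hX, POVM.observable, sub_smul, Finset.sum_sub_distrib, E.sum_eq_one]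
    rw [this]
    exact E.observable_posSemidef fun a => by linarith [(abs_le.mp (hα a)).2]
  have h2 : (1 + X).PosSemidef := by
    have : 1 + X = E.observable fun a => 1 + α a := by
      simp [hX, POVM.observable, add_smul, Finset.sum_add_distrib, E.sum_eq_one]
    rw [this]
    exact E.observable_posSemidef fun a => by linarith [(abs_le.mp (hα a)).1]
  -- The two congruences add up to `2 * (1 - X * X)`, as `1 + X` and `1 - X` commute.
  have h3 := (h1.conjTranspose_mul_mul_same (1 + X)).add (h2.conjTranspose_mul_mul_same (1 - X))
  have h4 := h3.smul (a := (2⁻¹ : ℝ)) (by norm_num)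
  have e : (1 - X * X) = (2⁻¹ : ℝ) • ((1 + X)ᴴ * (1 - X) * (1 + X) + (1 - X)ᴴ * (1 + X) * (1 - X)) := by
    have e' : (1 + X)ᴴ * (1 - X) * (1 + X) + (1 - X)ᴴ * (1 + X) * (1 - X)
        = (2 : ℝ) • (1 - X * X) := by
      rw [conjTranspose_add, conjTranspose_sub, conjTranspose_one, hXh, two_smul]
      noncomm_ring
    rw [e', smul_smul]
    norm_num
  rw [e]
  exact h4

end Observable

/-! ### Weak duality for quantum strategies. -/

section Strategy

variable {S T A B ι κ : Type*} [Fintype A] [Fintype B]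
  [Fintype ι] [DecidableEq ι] [Fintype κ] [DecidableEq κ]

theorem QuantumStrategy.sum_mul_answerProb (σ : QuantumStrategy S T A B ι κ) (s : S) (t : T)
    (α : A → ℝ) (β : B → ℝ) :
    ∑ a, ∑ b, α a * β b * σ.answerProb s t a b =
      (star σ.state ⬝ᵥ (((σ.alice s).observable α ⊗ₖ (σ.bob t).observable β) *ᵥ σ.state)).re := by
  have h : (σ.alice s).observable α ⊗ₖ (σ.bob t).observable β =
      ∑ a, ∑ b, ((α a * β b : ℝ) : ℂ) • ((σ.alice s).effect a ⊗ₖ (σ.bob t).effect b) := by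
    ext i j
    simp only [POVM.observable, kroneckerMap_apply, Matrix.sum_apply, Matrix.smul_apply, smul_eq_mul,
      Finset.sum_mul_sum]
    exact Finset.sum_congr rfl fun _ _ => Finset.sum_congr rfl fun _ _ => by push_cast; ring
  simp only [h, sum_mulVec, dotProduct_sum, smul_mulVec, dotProduct_smul, Complex.re_sum,
    smul_eq_mul, Complex.re_ofReal_mul, QuantumStrategy.answerProb]

theorem re_star_dotProduct_mulVec_le_one {k : Type*} [Fintype k] [DecidableEq k] {ψ : k → ℂ}
    (hψ : star ψ ⬝ᵥ ψ = 1) {X : Matrix k k ℂ} (hX : (1 - X).PosSemidef) :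
    (star ψ ⬝ᵥ (X *ᵥ ψ)).re ≤ 1 := by
  have h := (Complex.le_def.mp (hX.dotProduct_mulVec_nonneg ψ)).1
  rw [sub_mulVec, dotProduct_sub, one_mulVec, hψ] at h
  simpa using h

theorem star_mulVec_dotProduct_mulVec {k : Type*} [Fintype k] {X : Matrix k k ℂ}
    (hX : X.IsHermitian) (Y : Matrix k k ℂ) (ψ : k → ℂ) :
    star (X *ᵥ ψ) ⬝ᵥ (Y *ᵥ ψ) = star ψ ⬝ᵥ ((X * Y) *ᵥ ψ) := by
  rw [star_mulVec, hX.eq, ← dotProduct_mulVec, mulVec_mulVec]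

/-- Weak duality for quantum correlations: a dual certificate bounds the expectation of a weighted
correlation in every quantum strategy. -/
theorem QuantumStrategy.correlation_le [Fintype S] [Fintype T] [DecidableEq S] [DecidableEq T]
    (σ : QuantumStrategy S T A B ι κ) {C : Matrix S T ℝ} {p : S → ℝ} {q : T → ℝ}
    (h : (dualSlack C p q).PosSemidef) {α : A → ℝ} {β : B → ℝ}
    (hα : ∀ a, |α a| ≤ 1) (hβ : ∀ b, |β b| ≤ 1) :
    ∑ s, ∑ t, C s t * ∑ a, ∑ b, α a * β b * σ.answerProb s t a b ≤
      (∑ s, p s + ∑ t, q t) / 2 := by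
  let X : S → Matrix (ι × κ) (ι × κ) ℂ := fun s => (σ.alice s).observable α ⊗ₖ 1
  let Y : T → Matrix (ι × κ) (ι × κ) ℂ := fun t => 1 ⊗ₖ (σ.bob t).observable β
  have hX : ∀ s, (X s).IsHermitian := fun s => by
    simp only [X, IsHermitian, conjTranspose_kronecker, conjTranspose_one,
      ((σ.alice s).observable_isHermitian α).eq]
  have hY : ∀ t, (Y t).IsHermitian := fun t => by
    simp only [Y, IsHermitian, conjTranspose_kronecker, conjTranspose_one,
      ((σ.bob t).observable_isHermitian β).eq]
  have hXX : ∀ s, (1 - X s * X s).PosSemidef := fun s => by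
    have e : 1 - X s * X s =
        (1 - (σ.alice s).observable α * (σ.alice s).observable α) ⊗ₖ (1 : Matrix κ κ ℂ) := by
      rw [sub_eq_iff_eq_add]
      simp only [X, ← mul_kronecker_mul, ← add_kronecker, mul_one, sub_add_cancel,
        one_kronecker_one]
    rw [e]
    exact ((σ.alice s).one_sub_observable_sq_posSemidef hα).kronecker PosSemidef.one
  have hYY : ∀ t, (1 - Y t * Y t).PosSemidef := fun t => by
    have e : 1 - Y t * Y t =
        (1 : Matrix ι ι ℂ) ⊗ₖ (1 - (σ.bob t).observable β * (σ.bob t).observable β) := by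
      rw [sub_eq_iff_eq_add]
      simp only [Y, ← mul_kronecker_mul, ← kronecker_add, mul_one, sub_add_cancel,
        one_kronecker_one]
    rw [e]
    exact PosSemidef.one.kronecker ((σ.bob t).one_sub_observable_sq_posSemidef hβ)
  have hXY : ∀ s t, X s * Y t = (σ.alice s).observable α ⊗ₖ (σ.bob t).observable β := fun s t => by
    simp [X, Y, ← mul_kronecker_mul]
  -- The correlation becomes the inner product of `X s *ᵥ ψ` and `Y t *ᵥ ψ`, vectors of norm at most
  -- one.
  simp_rw [σ.sum_mul_answerProb, ← hXY, ← star_mulVec_dotProduct_mulVec (hX _)]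
  refine sum_mul_re_star_dotProduct_le h (fun s => ?_) (fun t => ?_)
  · rw [star_mulVec_dotProduct_mulVec (hX s)]
    exact re_star_dotProduct_mulVec_le_one σ.state_unit (hXX s)
  · rw [star_mulVec_dotProduct_mulVec (hY t)]
    exact re_star_dotProduct_mulVec_le_one σ.state_unit (hYY t)

theorem QuantumStrategy.sum_answerProb (σ : QuantumStrategy S T A B ι κ) (s : S) (t : T) :
    ∑ a, ∑ b, σ.answerProb s t a b = 1 := by
  have h := σ.sum_mul_answerProb s t (fun _ => 1) (fun _ => 1)
  simpa [POVM.observable, POVM.sum_eq_one, σ.state_unit] using h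

end Strategy

/-! ### Fourier expansion and the upper bounds on success probabilities. -/

section UpperBound

/-- The sign `(-1)^b` of a bit. -/
def bitSign (b : Bool) : ℝ := if b then -1 else 1

theorem abs_bitSign (b : Bool) : |bitSign b| = 1 := by cases b <;> simp [bitSign]

theorem ite_xor_eq (a b c : Bool) (x : ℝ) :
    (if decide (Bool.xor a b = c) = true then x else 0) =
      (1 + bitSign c * (bitSign a * bitSign b)) / 2 * x := by
  cases a <;> cases b <;> cases c <;> simp [bitSign]

variable {S T : Type*} [Fintype S] [Fintype T]

/-- The cost matrix of an XOR game. -/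
def XORGame.cost (G : XORGame S T) : Matrix S T ℝ :=
  Matrix.of fun s t => G.prob s t * bitSign (G.f s t)

/-- The two dual sums must equal `e` separately: under products each sum multiplies, whereas their
average would not. -/
theorem XORGame.exists_bias [DecidableEq S] [DecidableEq T] (G : XORGame S T) :
    ∃ e : ℝ, (∃ R ∈ correlationMatrices (S ⊕ T), correlationValue G.cost R = e) ∧
      ∃ p q, (dualSlack G.cost p q).PosSemidef ∧ ∑ s, p s = e ∧ ∑ t, q t = e := by
  obtain ⟨R, hR, hmax⟩ := exists_isMaxOn_correlationValue G.cost
  exact ⟨_, ⟨R, hR, rfl⟩, exists_dualSlack_posSemidef hR hmax⟩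

/-- The marginals certify the bound `1`, the quadratic form being the expectation of `(x s + y t) ^
2`. This covers the games outside `M` in the Fourier expansion. -/
theorem XORGame.exists_dualSlack_prob_posSemidef [DecidableEq S] [DecidableEq T]
    (G : XORGame S T) :
    ∃ p q, (dualSlack (Matrix.of G.prob) p q).PosSemidef ∧ ∑ s, p s = 1 ∧ ∑ t, q t = 1 := by
  refine ⟨fun s => ∑ t, G.prob s t, fun t => ∑ s, G.prob s t,
    dualSlack_posSemidef fun x y => ?_, G.prob_sum, by rw [Finset.sum_comm, G.prob_sum]⟩
  have e : ∑ t, (∑ s, G.prob s t) * y t ^ 2 = ∑ s, ∑ t, G.prob s t * y t ^ 2 := by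
    simp_rw [Finset.sum_mul]
    exact Finset.sum_comm
  rw [e]
  simp_rw [Finset.sum_mul, Finset.mul_sum, ← Finset.sum_add_distrib]
  refine Finset.sum_nonneg fun s _ => Finset.sum_nonneg fun t _ => ?_
  have := mul_nonneg (G.prob_nonneg s t) (sq_nonneg (x s + y t))
  simp only [of_apply]
  linarith

theorem QuantumStrategy.successProb_toGame {ι κ : Type*} [Fintype ι] [DecidableEq ι] [Fintype κ]
    [DecidableEq κ] (G : XORGame S T) (σ : QuantumStrategy S T Bool Bool ι κ) :
    σ.successProb G.toGame = (1 + ∑ s, ∑ t, G.cost s t *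
      ∑ a, ∑ b, bitSign a * bitSign b * σ.answerProb s t a b) / 2 := by
  have h : ∀ s t, ∑ a, ∑ b, (if G.toGame.accept s t a b = true then σ.answerProb s t a b else 0)
      = (1 + bitSign (G.f s t) *
        ∑ a, ∑ b, bitSign a * bitSign b * σ.answerProb s t a b) / 2 := fun s t => by
    have h1 : ∀ a b, (if G.toGame.accept s t a b = true then σ.answerProb s t a b else 0) =
        (1 + bitSign (G.f s t) * (bitSign a * bitSign b)) / 2 * σ.answerProb s t a b :=
      fun a b => ite_xor_eq a b _ _
    rw [← σ.sum_answerProb s t]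
    simp only [h1, Finset.mul_sum, ← Finset.sum_add_distrib,
      Finset.sum_div]
    exact Finset.sum_congr rfl fun _ _ => Finset.sum_congr rfl fun _ _ => by ring
  rw [QuantumStrategy.successProb, ← G.prob_sum]
  simp only [h, ← Finset.sum_add_distrib, Finset.sum_div]
  refine Finset.sum_congr rfl fun _ _ => Finset.sum_congr rfl fun _ _ => ?_
  simp only [XORGame.toGame, XORGame.cost, of_apply]
  ring

theorem QuantumStrategy.successProb_toGame_le [DecidableEq S] [DecidableEq T] {ι κ : Type*}
    [Fintype ι] [DecidableEq ι] [Fintype κ] [DecidableEq κ] (G : XORGame S T)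
    (σ : QuantumStrategy S T Bool Bool ι κ) {e : ℝ} {p : S → ℝ} {q : T → ℝ}
    (h : (dualSlack G.cost p q).PosSemidef) (hp : ∑ s, p s = e) (hq : ∑ t, q t = e) :
    σ.successProb G.toGame ≤ (1 + e) / 2 := by
  rw [σ.successProb_toGame G]
  have := σ.correlation_le h (fun a => (abs_bitSign a).le) (fun b => (abs_bitSign b).le)
  rw [hp, hq] at this
  linarith

variable {n : ℕ} {S T : Fin n → Type*} [∀ j, Fintype (S j)] [∀ j, Fintype (T j)]

/-- The winning indicator is a product of factors `(1 ± 1) / 2`; expanding it gives one character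
per subset `M`. -/
theorem ite_conjunction_accept_eq (G : ∀ j, XORGame (S j) (T j)) (s : ∀ j, S j) (t : ∀ j, T j)
    (a b : Fin n → Bool) (x : ℝ) :
    (if (XORGame.conjunction G).accept s t a b = true then x else 0) =
      (∑ M : Finset (Fin n), (∏ j ∈ M, bitSign ((G j).f (s j) (t j))) *
        ((∏ j ∈ M, bitSign (a j)) * (∏ j ∈ M, bitSign (b j)) * x)) / 2 ^ n := by
  have h1 : (if (XORGame.conjunction G).accept s t a b = true then x else 0) =
      (∏ j, (1 + bitSign ((G j).f (s j) (t j)) * (bitSign (a j) * bitSign (b j))) / 2) * x := by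
    have h2 : ∀ j, (1 + bitSign ((G j).f (s j) (t j)) * (bitSign (a j) * bitSign (b j))) / 2 =
        if decide (Bool.xor (a j) (b j) = (G j).f (s j) (t j)) = true then 1 else 0 := fun j => by
      rw [ite_xor_eq, mul_one]
    simp only [h2, Finset.prod_ite_zero]
    simp [XORGame.conjunction]
  rw [h1, Finset.prod_div_distrib, Finset.prod_one_add]
  simp only [Finset.powerset_univ, Finset.prod_const, Finset.card_univ, Fintype.card_fin,
    Finset.prod_mul_distrib]
  rw [div_mul_eq_mul_div, Finset.sum_mul]
  simp only [mul_assoc]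

/-- The success probability of the conjunction is bounded through its Fourier expansion: every
character contributes the bias of the XOR of a subset of the games. -/
theorem QuantumStrategy.successProb_conjunction_le [∀ j, DecidableEq (S j)]
    [∀ j, DecidableEq (T j)] {ι κ : Type*}
    [Fintype ι] [DecidableEq ι] [Fintype κ] [DecidableEq κ] (G : ∀ j, XORGame (S j) (T j))
    (σ : QuantumStrategy (∀ j, S j) (∀ j, T j) (Fin n → Bool) (Fin n → Bool) ι κ) {e : Fin n → ℝ}
    (h : ∀ j, ∃ p q, (dualSlack (G j).cost p q).PosSemidef ∧ ∑ s, p s = e j ∧ ∑ t, q t = e j) :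
    σ.successProb (XORGame.conjunction G) ≤ ∏ j, (1 + e j) / 2 := by
  -- The sign is kept only for games in `M`, so the product of these entries is the question
  -- probability times the character of `M`.
  let C : Finset (Fin n) → ∀ j, Matrix (S j) (T j) ℝ := fun M j =>
    if j ∈ M then (G j).cost else Matrix.of (G j).prob
  have hC : ∀ M (s : ∀ j, S j) (t : ∀ j, T j), ∏ j, C M j (s j) (t j) =
      (∏ j, (G j).prob (s j) (t j)) * ∏ j ∈ M, bitSign ((G j).f (s j) (t j)) := fun M s t => by
    have h1 : ∀ j, C M j (s j) (t j) =
        (G j).prob (s j) (t j) * if j ∈ M then bitSign ((G j).f (s j) (t j)) else 1 := fun j => by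
      by_cases hj : j ∈ M <;> simp [C, hj, XORGame.cost]
    simp only [h1, Finset.prod_mul_distrib, Finset.prod_ite_mem, Finset.univ_inter]
  have hcert : ∀ M j, ∃ p q, (dualSlack (C M j) p q).PosSemidef ∧
      ∑ s, p s = (if j ∈ M then e j else 1) ∧ ∑ t, q t = (if j ∈ M then e j else 1) :=
    fun M j => by
      by_cases hj : j ∈ M
      · simpa [C, hj] using h j
      · simpa [C, hj] using (G j).exists_dualSlack_prob_posSemidef
  have hM : ∀ M : Finset (Fin n), ∑ s : (∀ j, S j), ∑ t : (∀ j, T j),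
      (∏ j, C M j (s j) (t j)) * ∑ a : Fin n → Bool, ∑ b : Fin n → Bool,
        (∏ j ∈ M, bitSign (a j)) * (∏ j ∈ M, bitSign (b j)) * σ.answerProb s t a b ≤
      ∏ j ∈ M, e j := fun M => by
    choose p q hpq hp hq using hcert M
    have habs : ∀ a : Fin n → Bool, |∏ j ∈ M, bitSign (a j)| ≤ 1 := fun a => by
      rw [Finset.abs_prod]
      simp [abs_bitSign]
    have := σ.correlation_le (dualSlack_prod_posSemidef hpq) habs habs
    -- Both certificate sums factor to `∏ j ∈ M, e j`, hence so does their average.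
    rw [← Fintype.prod_sum, ← Fintype.prod_sum] at this
    simpa only [of_apply, hp, hq, Finset.prod_ite_mem, Finset.univ_inter, add_self_div_two] using this
  have hsum : σ.successProb (XORGame.conjunction G) = (∑ M : Finset (Fin n),
      ∑ s : (∀ j, S j), ∑ t : (∀ j, T j),
      (∏ j, C M j (s j) (t j)) * ∑ a : Fin n → Bool, ∑ b : Fin n → Bool,
        (∏ j ∈ M, bitSign (a j)) * (∏ j ∈ M, bitSign (b j)) * σ.answerProb s t a b) / 2 ^ n := by
    rw [Finset.sum_comm, QuantumStrategy.successProb, Finset.sum_div]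
    refine Finset.sum_congr rfl fun s _ => ?_
    rw [Finset.sum_comm, Finset.sum_div]
    refine Finset.sum_congr rfl fun t _ => ?_
    simp only [ite_conjunction_accept_eq, ← Finset.sum_div, hC]
    rw [mul_div_assoc']
    congr 1
    have h1 : ∀ a : Fin n → Bool, ∑ b : Fin n → Bool, ∑ M : Finset (Fin n),
        (∏ j ∈ M, bitSign ((G j).f (s j) (t j))) *
        ((∏ j ∈ M, bitSign (a j)) * (∏ j ∈ M, bitSign (b j)) * σ.answerProb s t a b) =
        ∑ M : Finset (Fin n), (∏ j ∈ M, bitSign ((G j).f (s j) (t j))) * ∑ b : Fin n → Bool,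
        ((∏ j ∈ M, bitSign (a j)) * (∏ j ∈ M, bitSign (b j)) * σ.answerProb s t a b) := fun a => by
      rw [Finset.sum_comm]
      simp only [Finset.mul_sum]
    simp only [h1]
    rw [Finset.sum_comm, Finset.mul_sum]
    refine Finset.sum_congr rfl fun M _ => ?_
    rw [← Finset.mul_sum, ← mul_assoc]
    rfl
  rw [hsum, Finset.prod_div_distrib, Finset.prod_one_add]
  simp only [Finset.powerset_univ, Finset.prod_const, Finset.card_univ, Fintype.card_fin]
  gcongr with M _
  exact hM M

end UpperBound

/-! ### Clifford generators and Tsirelson's construction. -/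

section Tsirelson

/-- Hermitian matrices satisfying the Clifford relations exist in every number. -/
theorem exists_clifford_generators (N : ℕ) :
    ∃ (ι : Type) (_ : Fintype ι) (_ : DecidableEq ι) (_ : Nonempty ι)
      (γ : Fin N → Matrix ι ι ℂ), (∀ i, (γ i).IsHermitian) ∧
      ∀ i j, γ i * γ j + γ j * γ i = if i = j then 2 else 0 := by
  induction N with
  | zero => exact ⟨Unit, inferInstance, inferInstance, inferInstance, Fin.elim0,
      fun i => i.elim0, fun i => i.elim0⟩
  | succ N ih =>
    obtain ⟨ι, _, _, _, γ, hH, hγ⟩ := ih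
    have two : fromBlocks (2 : Matrix ι ι ℂ) 0 0 (2 : Matrix ι ι ℂ) =
        (2 : Matrix (ι ⊕ ι) (ι ⊕ ι) ℂ) := by
      have : (2 : Matrix ι ι ℂ) = 1 + 1 := by norm_num
      rw [this, ← add_zero (0 : Matrix ι ι ℂ), ← fromBlocks_add, fromBlocks_one]
      norm_num
    -- In Pauli notation the new generator is `σ_x ⊗ 1` and the old ones become `σ_z ⊗ γ i`.
    refine ⟨ι ⊕ ι, inferInstance, inferInstance, inferInstance,
      Fin.cons (fromBlocks 0 1 1 0) fun i => fromBlocks (γ i) 0 0 (-γ i), fun i => ?_,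
      fun i j => ?_⟩
    · refine Fin.cases ?_ (fun i => ?_) i
      · simp [IsHermitian, fromBlocks_conjTranspose]
      · simp [IsHermitian, fromBlocks_conjTranspose, (hH i).eq]
    · refine Fin.cases ?_ (fun i => ?_) i <;> refine Fin.cases ?_ (fun j => ?_) j
      · simp only [Fin.cons_zero, fromBlocks_multiply, fromBlocks_add, if_true]
        rw [← two]
        norm_num
      · simp [fromBlocks_multiply, fromBlocks_add, (Fin.succ_ne_zero _).symm]
      · simp [fromBlocks_multiply, fromBlocks_add]
      · simp only [Fin.cons_succ, fromBlocks_multiply, fromBlocks_add, Fin.succ_inj]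
        have := hγ i j
        by_cases hij : i = j
        · simp only [if_pos hij] at this ⊢
          simp [this, two]
        · simp only [if_neg hij] at this ⊢
          simp [this]

/-- The two-outcome projective measurement of a Hermitian involution. -/
noncomputable def POVM.ofInvolution {ι : Type*} [Fintype ι] [DecidableEq ι] (X : Matrix ι ι ℂ)
    (hX : X.IsHermitian) (hX2 : X * X = 1) : POVM Bool ι where
  effect a := (2⁻¹ : ℂ) • (1 + (bitSign a : ℂ) • X)
  posSemidef a := by
    have h1 : ((2⁻¹ : ℂ) • (1 + (bitSign a : ℂ) • X))ᴴ = (2⁻¹ : ℂ) • (1 + (bitSign a : ℂ) • X) := by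
      simp [conjTranspose_smul, conjTranspose_add, hX.eq]
    -- The effect is a Hermitian idempotent, hence of the form `Pᴴ * P`.
    have h2 : (2⁻¹ : ℂ) • (1 + (bitSign a : ℂ) • X) =
        ((2⁻¹ : ℂ) • (1 + (bitSign a : ℂ) • X))ᴴ * ((2⁻¹ : ℂ) • (1 + (bitSign a : ℂ) • X)) := by
      rw [h1]
      have h3 : (bitSign a : ℂ) * bitSign a = 1 := by cases a <;> simp [bitSign]
      simp only [smul_mul_smul_comm, add_mul, mul_add, one_mul, mul_one, hX2, h3, one_smul]
      module
    rw [h2]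
    exact posSemidef_conjTranspose_mul_self _
  sum_eq_one := by
    simp only [Fintype.sum_bool, bitSign, if_true, Bool.false_eq_true, if_false]
    push_cast
    module

theorem POVM.ofInvolution_observable {ι : Type*} [Fintype ι] [DecidableEq ι] (X : Matrix ι ι ℂ)
    (hX : X.IsHermitian) (hX2 : X * X = 1) :
    (POVM.ofInvolution X hX hX2).observable bitSign = X := by
  simp only [POVM.observable, POVM.ofInvolution, Fintype.sum_bool, bitSign, if_true,
    Bool.false_eq_true, if_false]
  push_cast
  module

/-- The maximally entangled state. -/
noncomputable def maxEntangled (ι : Type*) [Fintype ι] [DecidableEq ι] : ι × ι → ℂ :=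
  fun x => if x.1 = x.2 then ((√(Fintype.card ι))⁻¹ : ℝ) else 0

/-- The maximally entangled state moves Bob's operator to Alice's side as a transpose. -/
theorem star_maxEntangled_dotProduct_kronecker_mulVec {ι : Type*} [Fintype ι] [DecidableEq ι]
    (X Y : Matrix ι ι ℂ) :
    star (maxEntangled ι) ⬝ᵥ ((X ⊗ₖ Y) *ᵥ maxEntangled ι) =
      (Fintype.card ι : ℂ)⁻¹ * (X * Yᵀ).trace := by
  have hc : (((√(Fintype.card ι))⁻¹ : ℝ) : ℂ) * (((√(Fintype.card ι))⁻¹ : ℝ) : ℂ) =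
      (Fintype.card ι : ℂ)⁻¹ := by
    rw [← Complex.ofReal_mul, ← mul_inv, Real.mul_self_sqrt (Nat.cast_nonneg _)]
    simp
  have hm : ∀ i k, ((X ⊗ₖ Y) *ᵥ maxEntangled ι) (i, k) =
      (∑ j, X i j * Y k j) * (((√(Fintype.card ι))⁻¹ : ℝ) : ℂ) := fun i k => by
    simp only [mulVec, dotProduct, maxEntangled, Fintype.sum_prod_type, kroneckerMap_apply,
      mul_ite, mul_zero, Finset.sum_ite_eq, Finset.mem_univ, if_true, Finset.sum_mul]
  simp only [dotProduct, Fintype.sum_prod_type, Pi.star_apply, hm]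
  simp only [maxEntangled, apply_ite star, star_zero, ite_mul, zero_mul, Finset.sum_ite_eq,
    Finset.mem_univ, if_true, trace, diag_apply, mul_apply, transpose_apply, Finset.mul_sum]
  refine Finset.sum_congr rfl fun i _ => ?_
  rw [← Finset.mul_sum, ← hc, Complex.star_def, Complex.conj_ofReal]
  ring

theorem star_maxEntangled_dotProduct_self {ι : Type*} [Fintype ι] [DecidableEq ι] [Nonempty ι] :
    star (maxEntangled ι) ⬝ᵥ maxEntangled ι = 1 := by
  have h := star_maxEntangled_dotProduct_kronecker_mulVec (1 : Matrix ι ι ℂ) 1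
  rw [one_kronecker_one, one_mulVec, transpose_one, mul_one, trace_one] at h
  rw [h, inv_mul_cancel₀]
  exact_mod_cast Fintype.card_ne_zero

open scoped MatrixOrder in
theorem exists_gram_of_posSemidef {m : Type*} [Fintype m] {R : Matrix m m ℝ}
    (hR : R.PosSemidef) : ∃ B : m → m → ℝ, ∀ a b, ∑ i, B a i * B b i = R a b := by
  classical
  obtain ⟨B, hB⟩ := CStarAlgebra.nonneg_iff_eq_star_mul_self.mp hR.nonneg
  refine ⟨fun a i => B i a, fun a b => ?_⟩
  rw [hB]
  simp [mul_apply, star_eq_conjTranspose]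

/-- Every correlation matrix is realised by involutions whose products have the prescribed
normalised traces. -/
theorem exists_involutions_of_correlation {m : Type*} [Fintype m] {R : Matrix m m ℝ}
    (hR : R ∈ correlationMatrices m) :
    ∃ (ι : Type) (_ : Fintype ι) (_ : DecidableEq ι) (_ : Nonempty ι) (X : m → Matrix ι ι ℂ),
      (∀ a, (X a).IsHermitian) ∧ (∀ a, X a * X a = 1) ∧
      ∀ a b, (X a * X b).trace = (R a b : ℂ) * Fintype.card ι := by
  obtain ⟨B, hB⟩ := exists_gram_of_posSemidef hR.1
  obtain ⟨ι, _, _, _, γ, hH, hγ⟩ := exists_clifford_generators (Fintype.card m)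
  classical
  let E := Fintype.equivFin m
  have hγE : ∀ i j, γ (E i) * γ (E j) + γ (E j) * γ (E i) = if i = j then 2 else 0 := fun i j => by
    simp [hγ]
  -- Gram vectors of `R` serve as Clifford coefficients, so anticommutators are `2 * R a b` times
  -- the identity. The unit diagonal gives `X a * X a = 1`, and the trace gives the correlations.
  let X : m → Matrix ι ι ℂ := fun a => ∑ i, (B a i : ℂ) • γ (E i)
  have hanti : ∀ a b, X a * X b + X b * X a = ((2 * R a b : ℝ) : ℂ) • 1 := fun a b => by
    have h1 : X a * X b + X b * X a =
        ∑ i, ∑ j, ((B a i * B b j : ℝ) : ℂ) • (γ (E i) * γ (E j) + γ (E j) * γ (E i)) := by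
      simp only [X, Finset.sum_mul_sum, smul_add, Finset.sum_add_distrib, smul_mul_smul_comm]
      congr 1
      · push_cast; rfl
      · rw [Finset.sum_comm]
        refine Finset.sum_congr rfl fun _ _ => Finset.sum_congr rfl fun _ _ => ?_
        push_cast
        rw [mul_comm]
    rw [h1]
    have two : (2 : Matrix ι ι ℂ) = (2 : ℂ) • 1 := by
      rw [two_smul]; norm_num
    simp only [hγE, smul_ite, smul_zero, Finset.sum_ite_eq, Finset.mem_univ,
      if_true]
    rw [← Finset.sum_smul, two, smul_smul, ← hB a b]
    push_cast
    rw [mul_comm]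
  refine ⟨ι, inferInstance, inferInstance, inferInstance, X, fun a => ?_, fun a => ?_,
    fun a b => ?_⟩
  · simp only [X, IsHermitian, conjTranspose_sum, conjTranspose_smul, (hH _).eq]
    simp
  · have h := hanti a a
    rw [hR.2, ← two_smul ℂ] at h
    have h' := congrArg ((2⁻¹ : ℂ) • ·) h
    simpa [smul_smul] using h'
  · have h := congrArg trace (hanti a b)
    rw [trace_add, trace_mul_comm (X b), trace_smul, trace_one] at h
    push_cast [smul_eq_mul] at h
    linear_combination h / 2

/-- Tsirelson's construction. -/
theorem exists_strategy_of_correlation {S T : Type*} [Fintype S] [Fintype T]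
    {R : Matrix (S ⊕ T) (S ⊕ T) ℝ} (hR : R ∈ correlationMatrices (S ⊕ T)) :
    ∃ (ι : Type) (_ : Fintype ι) (_ : DecidableEq ι) (σ : QuantumStrategy S T Bool Bool ι ι),
      ∀ s t, ∑ a, ∑ b, bitSign a * bitSign b * σ.answerProb s t a b =
        R (Sum.inl s) (Sum.inr t) := by
  obtain ⟨ι, _, _, _, X, hH, hX, htr⟩ := exists_involutions_of_correlation hR
  refine ⟨ι, inferInstance, inferInstance,
    { state := maxEntangled ι
      state_unit := star_maxEntangled_dotProduct_self
      alice := fun s => POVM.ofInvolution (X (Sum.inl s)) (hH _) (hX _)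
      -- Bob's transpose cancels the one produced by the maximally entangled state.
      bob := fun t => POVM.ofInvolution (X (Sum.inr t))ᵀ (hH _).transpose
        (by rw [← transpose_mul, hX, transpose_one]) }, fun s t => ?_⟩
  rw [QuantumStrategy.sum_mul_answerProb]
  simp only [POVM.ofInvolution_observable]
  rw [star_maxEntangled_dotProduct_kronecker_mulVec, transpose_transpose, htr]
  have : (Fintype.card ι : ℂ) ≠ 0 := by exact_mod_cast Fintype.card_ne_zero
  rw [mul_comm, mul_assoc, mul_inv_cancel₀ this, mul_one, Complex.ofReal_re]

theorem XORGame.correlationValue_mem_quantumSuccessProbs {S T : Type*} [Fintype S] [Fintype T]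
    (G : XORGame S T) {R : Matrix (S ⊕ T) (S ⊕ T) ℝ} (hR : R ∈ correlationMatrices (S ⊕ T)) :
    (1 + correlationValue G.cost R) / 2 ∈ G.toGame.quantumSuccessProbs := by
  obtain ⟨ι, i₁, i₂, σ, hσ⟩ := exists_strategy_of_correlation hR
  refine ⟨ι, ι, i₁, i₂, i₁, i₂, σ, ?_⟩
  simp only [σ.successProb_toGame, hσ, correlationValue]

end Tsirelson

/-! ### Independent play of strategies. -/

section ProductStrategy

variable {n : ℕ}

theorem Matrix.piTensor_one {ι : Fin n → Type*} [∀ j, DecidableEq (ι j)] :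
    Matrix.piTensor (fun j => (1 : Matrix (ι j) (ι j) ℂ)) = 1 := by
  ext x y
  by_cases h : x = y
  · subst h; simp [Matrix.piTensor]
  · obtain ⟨j, hj⟩ := Function.ne_iff.mp h
    rw [one_apply_ne h]
    exact Finset.prod_eq_zero (Finset.mem_univ j) (one_apply_ne hj)

/-- The product of a family of measurements. -/
noncomputable def POVM.pi {A ι : Fin n → Type*} [∀ j, Fintype (A j)] [∀ j, Fintype (ι j)]
    [∀ j, DecidableEq (ι j)] (E : ∀ j, POVM (A j) (ι j)) : POVM (∀ j, A j) (∀ j, ι j) where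
  effect a := Matrix.piTensor fun j => (E j).effect (a j)
  posSemidef a := PosSemidef.piTensor fun j => (E j).posSemidef (a j)
  sum_eq_one := by
    rw [← Matrix.piTensor_one]
    ext x y
    simp only [Matrix.sum_apply, Matrix.piTensor, of_apply]
    rw [← Fintype.prod_sum fun j a => (E j).effect a (x j) (y j)]
    refine Finset.prod_congr rfl fun j _ => ?_
    rw [← (E j).sum_eq_one, Matrix.sum_apply]

variable {ι κ : Fin n → Type*} [∀ j, Fintype (ι j)] [∀ j, Fintype (κ j)]

/-- The product of a family of bipartite states. -/
def piState (ψ : ∀ j, ι j × κ j → ℂ) : (∀ j, ι j) × (∀ j, κ j) → ℂ :=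
  fun x => ∏ j, ψ j (x.1 j, x.2 j)

theorem star_piState_dotProduct_mulVec (ψ : ∀ j, ι j × κ j → ℂ)
    (X : ∀ j, Matrix (ι j) (ι j) ℂ) (Y : ∀ j, Matrix (κ j) (κ j) ℂ) :
    star (piState ψ) ⬝ᵥ ((Matrix.piTensor X ⊗ₖ Matrix.piTensor Y) *ᵥ piState ψ) =
      ∏ j, star (ψ j) ⬝ᵥ ((X j ⊗ₖ Y j) *ᵥ ψ j) := by
  simp only [dotProduct, mulVec, Fintype.sum_prod_type, Finset.mul_sum, Pi.star_apply,
    kroneckerMap_apply]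
  simp only [Fintype.prod_sum, piState, Matrix.piTensor, of_apply, star_prod,
    Finset.prod_mul_distrib]

variable [∀ j, DecidableEq (ι j)] [∀ j, DecidableEq (κ j)]
  {S T A B : Fin n → Type*} [∀ j, Fintype (A j)] [∀ j, Fintype (B j)]

/-- The strategy which plays a family of strategies independently. -/
noncomputable def QuantumStrategy.pi (σ : ∀ j, QuantumStrategy (S j) (T j) (A j) (B j) (ι j) (κ j)) :
    QuantumStrategy (∀ j, S j) (∀ j, T j) (∀ j, A j) (∀ j, B j) (∀ j, ι j) (∀ j, κ j) where
  state := piState fun j => (σ j).state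
  state_unit := by
    have h := star_piState_dotProduct_mulVec (fun j => (σ j).state) (fun _ => 1) (fun _ => 1)
    simpa [Matrix.piTensor_one, (σ _).state_unit] using h
  alice s := POVM.pi fun j => (σ j).alice (s j)
  bob t := POVM.pi fun j => (σ j).bob (t j)

/-- Real parts are not multiplicative, so answer probabilities must be known to be real before they
are factored over the games. -/
theorem QuantumStrategy.ofReal_answerProb {S T A B ι κ : Type*} [Fintype A] [Fintype B]
    [Fintype ι] [DecidableEq ι] [Fintype κ] [DecidableEq κ] (σ : QuantumStrategy S T A B ι κ)
    (s : S) (t : T) (a : A) (b : B) :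
    (σ.answerProb s t a b : ℂ) =
      star σ.state ⬝ᵥ (((σ.alice s).effect a ⊗ₖ (σ.bob t).effect b) *ᵥ σ.state) := by
  have h := ((((σ.alice s).posSemidef a).kronecker
    ((σ.bob t).posSemidef b)).dotProduct_mulVec_nonneg σ.state)
  exact Complex.ext (by simp [QuantumStrategy.answerProb])
    (by simpa using (Complex.le_def.mp h).2)

theorem QuantumStrategy.answerProb_pi
    (σ : ∀ j, QuantumStrategy (S j) (T j) (A j) (B j) (ι j) (κ j)) (s : ∀ j, S j) (t : ∀ j, T j)
    (a : ∀ j, A j) (b : ∀ j, B j) :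
    (QuantumStrategy.pi σ).answerProb s t a b = ∏ j, (σ j).answerProb (s j) (t j) (a j) (b j) := by
  apply Complex.ofReal_injective
  rw [QuantumStrategy.ofReal_answerProb, Complex.ofReal_prod]
  simp only [QuantumStrategy.ofReal_answerProb]
  exact star_piState_dotProduct_mulVec _ _ _

theorem QuantumStrategy.successProb_pi [∀ j, Fintype (S j)] [∀ j, Fintype (T j)]
    (G : ∀ j, XORGame (S j) (T j))
    (σ : ∀ j, QuantumStrategy (S j) (T j) Bool Bool (ι j) (κ j)) :
    (QuantumStrategy.pi σ).successProb (XORGame.conjunction G) =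
      ∏ j, (σ j).successProb (G j).toGame := by
  have h : ∀ s t a b, (if (XORGame.conjunction G).accept s t a b = true then
      (QuantumStrategy.pi σ).answerProb s t a b else 0) =
      ∏ j, if (G j).toGame.accept (s j) (t j) (a j) (b j) = true then
        (σ j).answerProb (s j) (t j) (a j) (b j) else 0 := fun s t a b => by
    rw [Finset.prod_ite_zero, QuantumStrategy.answerProb_pi]
    simp [XORGame.conjunction, XORGame.toGame]
  simp only [QuantumStrategy.successProb, h, Fintype.prod_sum, Finset.prod_mul_distrib]
  rfl

end ProductStrategy

/-! ### Attainment and multiplicativity of the quantum value. -/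

theorem TwoPlayerGame.isGreatest_quantumValue {S T A B : Type*} [Fintype S] [Fintype T]
    [Fintype A] [Fintype B] {G : TwoPlayerGame S T A B} {w : ℝ}
    (h : IsGreatest G.quantumSuccessProbs w) :
    IsGreatest G.quantumSuccessProbs G.quantumValue ∧ G.quantumValue = w := by
  have e : G.quantumValue = w := h.csSup_eq
  exact ⟨e ▸ h, e⟩

/-- The quantum values are maxima (they are attained), and the quantum value of the conjunction is
the product of the quantum values of the games. -/
theorem theorem2 {n : ℕ} {S T : Fin n → Type*} [∀ j, Fintype (S j)] [∀ j, Fintype (T j)]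
    (G : ∀ j, XORGame (S j) (T j)) :
    (∀ j, IsGreatest (G j).toGame.quantumSuccessProbs (G j).toGame.quantumValue) ∧
    IsGreatest (XORGame.conjunction G).quantumSuccessProbs
      (XORGame.conjunction G).quantumValue ∧
    (XORGame.conjunction G).quantumValue = ∏ j, (G j).toGame.quantumValue := by
  classical
  choose e hattain hcert using fun j => (G j).exists_bias
  have hmem : ∀ j, (1 + e j) / 2 ∈ (G j).toGame.quantumSuccessProbs := fun j => by
    obtain ⟨R, hR, hRe⟩ := hattain j
    exact hRe ▸ (G j).correlationValue_mem_quantumSuccessProbs hR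
  have hgreat : ∀ j, IsGreatest (G j).toGame.quantumSuccessProbs ((1 + e j) / 2) := fun j => by
    refine ⟨hmem j, ?_⟩
    rintro _ ⟨ι, κ, _, _, _, _, σ, rfl⟩
    obtain ⟨p, q, hpq, hp, hq⟩ := hcert j
    exact σ.successProb_toGame_le (G j) hpq hp hq
  have hconj : IsGreatest (XORGame.conjunction G).quantumSuccessProbs (∏ j, (1 + e j) / 2) := by
    constructor
    · choose ι κ i₁ i₂ i₃ i₄ σ hσ using hmem
      exact ⟨∀ j, ι j, ∀ j, κ j, inferInstance, inferInstance, inferInstance, inferInstance,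
        QuantumStrategy.pi σ, by simp only [QuantumStrategy.successProb_pi, hσ]⟩
    · rintro _ ⟨ι, κ, _, _, _, _, σ, rfl⟩
      exact σ.successProb_conjunction_le G hcert
  have hval := fun j => TwoPlayerGame.isGreatest_quantumValue (hgreat j)
  have hvalc := TwoPlayerGame.isGreatest_quantumValue hconj
  refine ⟨fun j => (hval j).1, hvalc.1, ?_⟩
  rw [hvalc.2]
  exact Finset.prod_congr rfl fun j _ => (hval j).2.symm
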